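/- Lemma 2.3 (Rademacher complexity bounds for norm-constrained ReLU networks). Let $d,k,W,L\ge 1$ be integers, let $K\ge 0$, and let $\sigma(t)=\max\{t,0\}$, applied entrywise to vectors. For $x\in\mathbb{R}^d$ write $\tilde x=(x^\top,1)^\top\in\mathbb{R}^{d+1}$, and for a real matrix $A$ let $\|A\|:=\sup_{\|y\|_\infty\le 1}\|Ay\|_\infty$. Let $\mathcal{SNN}_{d,k}(W,L,K)$ be the set of all functions $\phi:\mathbb{R}^d\to\mathbb{R}^k$ of the form $$\phi(x)=A_L\,\sigma(A_{L-1}\,\sigma(\cdots\sigma(A_0\tilde x)\cdots)),$$ where $A_\ell\in\mathbb{R}^{N_{\ell+1}\times N_\ell}$ for $0\le\ell\le L$, $N_0=d+1$, $N_{L+1}=k$, $N_1,\dots,N_L\ge 1$, $\max\{N_1,\dots,N_L\}=W$ and $\prod_{\ell=0}^L\|A_\ell\|\le K$. For a non-empty bounded set $S\subseteq\mathbb{R}^n$ let $$\mathcal{R}_n(S):=\mathbb{E}_{\xi}\Big[\sup_{s\in S}\frac1n\sum_{i=1}^n\xi_i s_i\Big],$$ where $\xi_1,\dots,\xi_n$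 are independent random signs, each equal to $1$ or $-1$ with probability $1/2$. Let $n\ge 1$, $B\ge 1$, $x_1,\dots,x_n\in[-B,B]^d$, and let $x_{i,j}$ denote the $j$-th coordinate of $\tilde x_i\in\mathbb{R}^{d+1}$. Then the set $S:=\{(\phi(x_1),\dots,\phi(x_n)):\phi\in\mathcal{SNN}_{d,1}(W,L,K)\}\subseteq\mathbb{R}^n$ is non-empty and bounded, and $$\mathcal{R}_n(S)\le\frac1n K\sqrt{2(L+2+\log(d+1))}\max_{1\le j\le d+1}\sqrt{\sum_{i=1}^n x_{i,j}^2}\le\frac{BK\sqrt{2(L+2+\log(d+1))}}{\sqrt n}.$$ If moreover $W\ge 2$, then $$\mathcal{R}_n(S)\ge\frac{K}{2\sqrt2\,n}\max_{1\le j\le d+1}\sqrt{\sum_{i=1}^n x_{i,j}^2}\ge\frac{K}{2\sqrt{2n}}.$$ -/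

import Mathlib

/-- The ReLU function `σ(t) = t ∨ 0`. -/
def relu (t : ℝ) : ℝ := max t 0

/-- The matrix norm `‖A‖ = sup_{‖x‖_∞ ≤ 1} ‖A x‖_∞`: the operator norm of `x ↦ A x`, where
`Fin n → ℝ` and `Fin m → ℝ` carry their sup norms (the default norms of these types). -/
noncomputable def matNorm {m n : ℕ} (A : Matrix (Fin m) (Fin n) ℝ) : ℝ :=
  ‖LinearMap.toContinuousLinearMap (Matrix.mulVecLin A)‖

/-- `HiddenLayers m L p` is the type of weight matrices `(A₀, …, A_{L-1})` of `L` consecutive hidden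
layers without biases, where `A_ℓ` has size `N_{ℓ+1} × N_ℓ`, with input dimension `N₀ = m`
and last dimension `N_L = p`; the intermediate dimensions are arbitrary. -/
inductive HiddenLayers (m : ℕ) : ℕ → ℕ → Type
  | nil : HiddenLayers m 0 m
  | snoc {L q p : ℕ} (H : HiddenLayers m L q) (A : Matrix (Fin p) (Fin q) ℝ) :
      HiddenLayers m (L + 1) p

namespace HiddenLayers

/-- The output `σ(A_{L-1} σ(⋯ σ(A₀ y)))` of the hidden layers on the input `y`. -/
noncomputable def eval {m : ℕ} : {L p : ℕ} → HiddenLayers m L p → (Fin m → ℝ) → (Fin p → ℝ)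
  | _, _, nil, y => y
  | _, _, snoc H A, y => fun i => relu (A.mulVec (H.eval y) i)

/-- The product `∏_{ℓ < L} ‖A_ℓ‖`. -/
noncomputable def normProd {m : ℕ} : {L p : ℕ} → HiddenLayers m L p → ℝ
  | _, _, nil => 1
  | _, _, snoc H A => H.normProd * matNorm A

/-- The width `max {N₁, …, N_L}` (and `0` if there is no hidden layer). -/
def width {m : ℕ} : {L p : ℕ} → HiddenLayers m L p → ℕ
  | _, _, nil => 0
  | _, _, snoc (p := p) H _ => max H.width p

/-- All the dimensions `N₁, …, N_L` are at least `1`. -/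
def PosWidths {m : ℕ} : {L p : ℕ} → HiddenLayers m L p → Prop
  | _, _, nil => True
  | _, _, snoc (p := p) H _ => H.PosWidths ∧ 1 ≤ p

end HiddenLayers

/-- The augmented vector `x̃ = (x, 1)`. -/
def augment {d : ℕ} (x : Fin d → ℝ) : Fin (d + 1) → ℝ :=
  Fin.snoc (α := fun _ => ℝ) x 1

/-- The class `SNN_{d,k}(W, L, K)` of functions `x ↦ A_L σ(A_{L-1} σ(⋯ σ(A₀ x̃)))` of width
`max {N₁, …, N_L} = W`, depth `L`, and with `∏_{ℓ ≤ L} ‖A_ℓ‖ ≤ K`. -/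
def SNN (d k W L : ℕ) (K : ℝ) : Set ((Fin d → ℝ) → (Fin k → ℝ)) :=
  {φ | ∃ (p : ℕ) (H : HiddenLayers (d + 1) L p) (A : Matrix (Fin k) (Fin p) ℝ),
    H.PosWidths ∧ H.width = W ∧ H.normProd * matNorm A ≤ K ∧
    ∀ x, φ x = A.mulVec (H.eval (augment x))}

/-- The set `{(φ(x₁), …, φ(x_n)) : φ ∈ SNN_{d,1}(W, L, K)} ⊆ ℝⁿ`. -/
def sampleSet {d n : ℕ} (W L : ℕ) (K : ℝ) (x : Fin n → Fin d → ℝ) : Set (Fin n → ℝ) :=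
  {s | ∃ φ ∈ SNN d 1 W L K, ∀ i, s i = φ (x i) 0}

/-- The Rademacher complexity of `S ⊆ ℝⁿ`: the expectation of
`sup_{s ∈ S} (1/n) ∑ᵢ ξᵢ sᵢ` over a uniformly distributed sign vector `ξ ∈ {1, -1}ⁿ`, that is, over
independent signs `ξᵢ` with equal probabilities `1/2`. The supremum is the one of `ℝ`, hence
meaningful for non-empty bounded `S`. -/
noncomputable def rademacherComplexity {n : ℕ} (S : Set (Fin n → ℝ)) : ℝ :=
  (1 / 2 ^ n : ℝ) *
    ∑ ξ : Fin n → ℤˣ, sSup ((fun s : Fin n → ℝ => (1 / n : ℝ) * ∑ i, ((ξ i : ℤ) : ℝ) * s i) '' S)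

/-- The largest column norm `max_{1 ≤ j ≤ d+1} √(∑ᵢ x̃_{i,j}²)` of the augmented data. -/
noncomputable def maxColNorm {d n : ℕ} (x : Fin n → Fin d → ℝ) : ℝ :=
  Finset.univ.sup' Finset.univ_nonempty
    (fun j : Fin (d + 1) => Real.sqrt (∑ i, (augment (x i) j) ^ 2))

/-! Upper bound: rows of `A` have ℓ¹ norm at most `matNorm A` and `relu` is positively homogeneous,
so all weights normalize. Neuron values on the sample are the product of norms times a point of
`layerSet T L`, where `T` consists of the `d + 1` columns of the augmented data. Each layer passes
to absolutely convex combinations, then applies `relu`. Combinations are caught by `bipolar`, which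
leaves suprema of absolute linear functionals unchanged; `relu` is removed by contraction
(`sum_iSup_exp_relu_le`). Working with exponential moments, a layer costs a factor 2 inside the
logarithm, hence an additive term. A union bound over the columns, Jensen and the best exponent
finish.

Lower bound: the class contains `±K * relu (e * x̃_j)` with `e = ±1`. One choice of `e` keeps half
of the squared column norm, and Khintchine's inequality (`half_sqrt_le_sum_abs_signSum`) applies. -/

/-- The pairing `∑ᵢ ξᵢ sᵢ` of a sign vector with a real vector. -/
noncomputable def signSum {n : ℕ} (ξ : Fin n → ℤˣ) (s : Fin n → ℝ) : ℝ :=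
  ∑ i, ((ξ i : ℤ) : ℝ) * s i

/-! ### Moments of sign sums -/

theorem signSum_cons {n : ℕ} (e : ℤˣ) (ξ : Fin n → ℤˣ) (s : Fin (n + 1) → ℝ) :
    signSum (Fin.cons e ξ : Fin (n + 1) → ℤˣ) s
      = ((e : ℤ) : ℝ) * s 0 + signSum ξ (fun i => s i.succ) := by
  simp [signSum, Fin.sum_univ_succ]

theorem signSum_neg_left {n : ℕ} (ξ : Fin n → ℤˣ) (s : Fin n → ℝ) :
    signSum (-ξ) s = -signSum ξ s := by
  simp [signSum, Finset.sum_neg_distrib]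

theorem signSum_smul {n : ℕ} (ξ : Fin n → ℤˣ) (c : ℝ) (s : Fin n → ℝ) :
    signSum ξ (fun i => c * s i) = c * signSum ξ s := by
  simp only [signSum, Finset.mul_sum]
  exact Finset.sum_congr rfl fun i _ => by ring

theorem abs_sign_mul (e : ℤˣ) (a : ℝ) : |((e : ℤ) : ℝ) * a| = |a| := by
  rcases Int.units_eq_one_or e with rfl | rfl <;> simp

theorem abs_signSum_le {n : ℕ} (ξ : Fin n → ℤˣ) {s : Fin n → ℝ} {C : ℝ} (h : ∀ i, |s i| ≤ C) :
    |signSum ξ s| ≤ n * C := by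
  refine (Finset.abs_sum_le_sum_abs _ _).trans ?_
  refine (Finset.sum_le_sum fun i _ => (abs_sign_mul (ξ i) (s i)).le.trans (h i)).trans ?_
  simp

theorem sum_signs_succ {n : ℕ} (f : (Fin (n + 1) → ℤˣ) → ℝ) :
    ∑ ξ, f ξ = ∑ ξ : Fin n → ℤˣ, (f (Fin.cons 1 ξ) + f (Fin.cons (-1) ξ)) := by
  rw [← (Fin.consEquiv (fun _ : Fin (n + 1) => ℤˣ)).sum_comp, Fintype.sum_prod_type,
    Finset.sum_add_distrib]
  simp [UnitsInt.univ, Fin.consEquiv]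

theorem card_signs (n : ℕ) : (Fintype.card (Fin n → ℤˣ) : ℝ) = 2 ^ n := by
  simp

theorem sum_exp_signSum_le {n : ℕ} (s : Fin n → ℝ) :
    ∑ ξ : Fin n → ℤˣ, Real.exp (signSum ξ s) ≤ 2 ^ n * Real.exp ((∑ i, s i ^ 2) / 2) := by
  induction n with
  | zero => simp [signSum]
  | succ n ih =>
    rw [sum_signs_succ]
    have h : ∀ ξ : Fin n → ℤˣ,
        Real.exp (signSum (Fin.cons 1 ξ : Fin (n + 1) → ℤˣ) s)
          + Real.exp (signSum (Fin.cons (-1) ξ : Fin (n + 1) → ℤˣ) s)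
        = (2 * Real.cosh (s 0)) * Real.exp (signSum ξ fun i => s i.succ) := by
      intro ξ
      rw [signSum_cons, signSum_cons, Real.exp_add, Real.exp_add, Real.cosh_eq]
      simp
      ring
    simp_rw [h]
    rw [← Finset.mul_sum, Fin.sum_univ_succ, add_div, Real.exp_add]
    calc _ ≤ (2 * Real.exp (s 0 ^ 2 / 2)) *
          (2 ^ n * Real.exp ((∑ i : Fin n, s i.succ ^ 2) / 2)) := by
          have := Real.cosh_le_exp_half_sq (s 0)
          have := ih (fun i => s i.succ)
          gcongr
      _ = _ := by ring

theorem sum_signSum_sq {n : ℕ} (s : Fin n → ℝ) :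
    ∑ ξ : Fin n → ℤˣ, signSum ξ s ^ 2 = 2 ^ n * ∑ i, s i ^ 2 := by
  induction n with
  | zero => simp [signSum]
  | succ n ih =>
    rw [sum_signs_succ]
    have h : ∀ ξ : Fin n → ℤˣ,
        signSum (Fin.cons 1 ξ : Fin (n + 1) → ℤˣ) s ^ 2
          + signSum (Fin.cons (-1) ξ : Fin (n + 1) → ℤˣ) s ^ 2
        = 2 * s 0 ^ 2 + 2 * (signSum ξ fun i => s i.succ) ^ 2 := by
      intro ξ
      rw [signSum_cons, signSum_cons]
      simp
      ring
    simp_rw [h]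
    rw [Finset.sum_add_distrib, Finset.sum_const, ← Finset.mul_sum, ih, Finset.card_univ,
      nsmul_eq_mul, card_signs, Fin.sum_univ_succ]
    ring

/-- Splitting off one sign, with `v` the sum of the other squares, the mean is at most `s₀⁴ + 6 s₀²
v + 3 v²`, which is at most `3 (s₀² + v)²`. -/
theorem sum_signSum_pow_four_le {n : ℕ} (s : Fin n → ℝ) :
    ∑ ξ : Fin n → ℤˣ, signSum ξ s ^ 4 ≤ 3 * 2 ^ n * (∑ i, s i ^ 2) ^ 2 := by
  induction n with
  | zero => simp [signSum]
  | succ n ih =>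
    rw [sum_signs_succ]
    have h : ∀ ξ : Fin n → ℤˣ,
        signSum (Fin.cons 1 ξ : Fin (n + 1) → ℤˣ) s ^ 4
          + signSum (Fin.cons (-1) ξ : Fin (n + 1) → ℤˣ) s ^ 4
        = 2 * s 0 ^ 4 + 12 * s 0 ^ 2 * (signSum ξ fun i => s i.succ) ^ 2
          + 2 * (signSum ξ fun i => s i.succ) ^ 4 := by
      intro ξ
      rw [signSum_cons, signSum_cons]
      simp
      ring
    simp_rw [h]
    rw [Finset.sum_add_distrib, Finset.sum_add_distrib, Finset.sum_const, ← Finset.mul_sum,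
      ← Finset.mul_sum, sum_signSum_sq, Finset.card_univ, nsmul_eq_mul, card_signs,
      Fin.sum_univ_succ]
    have := ih (fun i => s i.succ)
    have h2 : (0 : ℝ) ≤ 2 ^ n * s 0 ^ 4 := by positivity
    rw [pow_succ (2 : ℝ)]
    nlinarith

/-- Khintchine's inequality in `L¹`, with the constant `1 / 2`. -/
theorem half_sqrt_le_sum_abs_signSum {n : ℕ} (s : Fin n → ℝ) :
    2 ^ n * (1 / 2 * √(∑ i, s i ^ 2)) ≤ ∑ ξ : Fin n → ℤˣ, |signSum ξ s| := by
  set v := ∑ i, s i ^ 2 with hv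
  have hv0 : 0 ≤ v := Finset.sum_nonneg fun i _ => sq_nonneg _
  rcases hv0.eq_or_lt with h0 | hpos
  · rw [← h0]
    simp only [Real.sqrt_zero, mul_zero]
    exact Finset.sum_nonneg fun i _ => abs_nonneg _
  set r := √v with hr
  have hrpos : 0 < r := Real.sqrt_pos.2 hpos
  have hrv : r ^ 2 = v := Real.sq_sqrt hv0
  -- The difference of the sides is `|y|` times a cubic with double root `3r/2`. Averaging with
  -- second moment `r²` and fourth moment at most `3r⁴` leaves `(1 - 4/9) r⁴ ≥ r⁴ / 2`.
  have key : ∀ y : ℝ, r ^ 2 * y ^ 2 - 4 / 27 * y ^ 4 ≤ r ^ 3 * |y| := by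
    intro y
    have h2 : y ^ 2 = |y| ^ 2 := (sq_abs y).symm
    have h4 : y ^ 4 = |y| ^ 4 := by rw [show y ^ 4 = (y ^ 2) ^ 2 by ring, h2]; ring
    rw [h2, h4]
    have hy := abs_nonneg y
    have : 0 ≤ |y| * (4 / 27 * (|y| - 3 / 2 * r) ^ 2 * (|y| + 3 * r)) := by positivity
    nlinarith
  have hsum := Finset.sum_le_sum fun (ξ : Fin n → ℤˣ) (_ : ξ ∈ Finset.univ) => key (signSum ξ s)
  rw [Finset.sum_sub_distrib, ← Finset.mul_sum, ← Finset.mul_sum, ← Finset.mul_sum,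
    sum_signSum_sq, ← hv, ← hrv] at hsum
  have h4 := sum_signSum_pow_four_le s
  rw [← hv, ← hrv] at h4
  have h2n : (0 : ℝ) ≤ 2 ^ n * r ^ 4 := by positivity
  refine le_of_mul_le_mul_left (a := r ^ 3) ?_ (by positivity)
  nlinarith

/-! ### Contraction for `relu` -/

theorem relu_nonneg (t : ℝ) : 0 ≤ relu t := le_max_right _ _

theorem abs_relu_le (t : ℝ) : |relu t| ≤ |t| := by
  rw [abs_of_nonneg (relu_nonneg t)]
  exact max_le (le_abs_self t) (abs_nonneg t)

theorem relu_mul {c : ℝ} (hc : 0 ≤ c) (t : ℝ) : relu (c * t) = c * relu t := by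
  simp [relu, mul_max_of_nonneg _ _ hc]

theorem relu_of_nonneg {t : ℝ} (h : 0 ≤ t) : relu t = t := max_eq_left h

theorem relu_of_nonpos {t : ℝ} (h : t ≤ 0) : relu t = 0 := max_eq_right h

theorem relu_sq_add_relu_neg_sq (t : ℝ) : relu t ^ 2 + relu (-t) ^ 2 = t ^ 2 := by
  rcases le_total 0 t with h | h
  · rw [relu_of_nonneg h, relu_of_nonpos (by linarith)]; ring
  · rw [relu_of_nonpos h, relu_of_nonneg (by linarith)]; ring

/-- Majorization for `exp`: expand `(e^q - e^a) (e^q - e^b) ≥ 0` and use `e^a e^b ≤ e^p e^q`. -/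
theorem exp_add_exp_le_of_add_le {a b p q : ℝ} (h : a + b ≤ p + q) (ha : a ≤ q) (hb : b ≤ q) :
    Real.exp a + Real.exp b ≤ Real.exp p + Real.exp q := by
  have h1 : Real.exp a * Real.exp b ≤ Real.exp p * Real.exp q := by
    rw [← Real.exp_add, ← Real.exp_add]; exact Real.exp_le_exp.2 h
  have h2 := Real.exp_le_exp.2 ha
  have h3 := Real.exp_le_exp.2 hb
  refine le_of_mul_le_mul_left (a := Real.exp q) ?_ (Real.exp_pos q)
  nlinarith [mul_nonneg (sub_nonneg.2 h2) (sub_nonneg.2 h3)]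

theorem exp_relu_contraction (a b u v : ℝ) :
    Real.exp (a + relu u) + Real.exp (b - relu v)
      ≤ Real.exp (max (a + u) (b + v)) + Real.exp (max (a - u) (b - v)) := by
  rcases le_total 0 u with hu | hu <;> rcases le_total 0 v with hv | hv
  · rw [relu_of_nonneg hu, relu_of_nonneg hv]
    exact add_le_add (Real.exp_le_exp.2 (le_max_left _ _)) (Real.exp_le_exp.2 (le_max_right _ _))
  · rw [relu_of_nonneg hu, relu_of_nonpos hv]
    refine add_le_add (Real.exp_le_exp.2 (le_max_left _ _)) (Real.exp_le_exp.2 ?_)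
    exact le_trans (by linarith) (le_max_right _ _)
  all_goals
    first
      | rw [relu_of_nonpos hu, relu_of_nonneg hv]
      | rw [relu_of_nonpos hu, relu_of_nonpos hv]
    have h1 := le_max_left (a + u) (b + v)
    have h2 := le_max_right (a + u) (b + v)
    have h3 := le_max_left (a - u) (b - v)
    have h4 := le_max_right (a - u) (b - v)
    refine exp_add_exp_le_of_add_le ?_ ?_ ?_ <;> rcases le_total u v <;> linarith

/-- Two indices `s`, `t` serve the two suprema on the left; each maximum in the two-point inequality
is attained at one of them. `hC` keeps the suprema on the right from taking the default value 0. -/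
theorem iSup_exp_relu_contraction {ι : Type*} [Nonempty ι] (a u : ι → ℝ) {C : ℝ}
    (hC : ∀ s, a s + |u s| ≤ C) :
    (⨆ s, Real.exp (a s + relu (u s))) + (⨆ s, Real.exp (a s - relu (u s)))
      ≤ (⨆ s, Real.exp (a s + u s)) + ⨆ s, Real.exp (a s - u s) := by
  have hb1 : BddAbove (Set.range fun s => Real.exp (a s + u s)) := by
    refine ⟨Real.exp C, ?_⟩
    rintro _ ⟨s, rfl⟩
    exact Real.exp_le_exp.2 (by linarith [hC s, le_abs_self (u s)])
  have hb2 : BddAbove (Set.range fun s => Real.exp (a s - u s)) := by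
    refine ⟨Real.exp C, ?_⟩
    rintro _ ⟨s, rfl⟩
    exact Real.exp_le_exp.2 (by linarith [hC s, neg_abs_le (u s)])
  refine ciSup_add_ciSup_le fun s t => ?_
  refine (exp_relu_contraction (a s) (a t) (u s) (u t)).trans (add_le_add ?_ ?_)
  · rcases max_choice (a s + u s) (a t + u t) with h | h <;> rw [h]
    exacts [le_ciSup hb1 s, le_ciSup hb1 t]
  · rcases max_choice (a s - u s) (a t - u t) with h | h <;> rw [h]
    exacts [le_ciSup hb2 s, le_ciSup hb2 t]

/-- The Ledoux–Talagrand contraction principle for `relu` and exponential moments. -/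
theorem sum_iSup_exp_relu_le {ι : Type*} [Nonempty ι] {n : ℕ} (a : ι → ℝ) (u : ι → Fin n → ℝ)
    {A C : ℝ} (hA : ∀ s, a s ≤ A) (hC : ∀ s i, |u s i| ≤ C) :
    ∑ ξ : Fin n → ℤˣ, ⨆ s, Real.exp (a s + signSum ξ fun i => relu (u s i))
      ≤ ∑ ξ : Fin n → ℤˣ, ⨆ s, Real.exp (a s + signSum ξ (u s)) := by
  -- The offset `a` absorbs the term of the first sign, while the remaining signs are treated by
  -- induction.
  induction n generalizing a A with
  | zero => simp [signSum]
  | succ n ih =>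
    rw [sum_signs_succ, sum_signs_succ]
    simp only [signSum_cons, Units.val_one, Units.val_neg, Int.cast_one, Int.cast_neg, one_mul,
      neg_one_mul, ← add_assoc]
    have hr : ∀ s i, |relu (u s i)| ≤ C := fun s i => (abs_relu_le _).trans (hC s i)
    have h1 := ih (fun s => a s + relu (u s 0)) (fun s i => u s i.succ) (A := A + C)
      (fun s => add_le_add (hA s) ((le_abs_self _).trans (hr s 0))) (fun s i => hC s i.succ)
    have h2 := ih (fun s => a s + -relu (u s 0)) (fun s i => u s i.succ) (A := A + C)
      (fun s => add_le_add (hA s) ((neg_le_abs _).trans (hr s 0))) (fun s i => hC s i.succ)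
    rw [Finset.sum_add_distrib]
    refine (add_le_add h1 h2).trans ?_
    rw [← Finset.sum_add_distrib]
    refine Finset.sum_le_sum fun ξ _ => ?_
    have h3 := iSup_exp_relu_contraction (fun s => a s + signSum ξ fun i => u s i.succ)
      (fun s => u s 0) (C := A + n * C + C) (fun s => add_le_add (add_le_add (hA s)
        ((le_abs_self _).trans (abs_signSum_le ξ fun i => hC s i.succ))) (hC s 0))
    refine le_trans (le_of_eq ?_) (h3.trans (le_of_eq ?_)) <;>
    · congr 1 <;> refine congrArg _ (funext fun s => ?_) <;> congr 1 <;> ring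

/-! ### Absolutely convex combinations through the bipolar -/

/-- The bipolar of `T`: the vectors whose pairing with every `c` is at most the largest pairing
of `c` with `T`, in absolute value. -/
def bipolar {n : ℕ} (T : Set (Fin n → ℝ)) : Set (Fin n → ℝ) :=
  {s | ∀ (c : Fin n → ℝ) (M : ℝ), (∀ t ∈ T, |∑ i, c i * t i| ≤ M) → |∑ i, c i * s i| ≤ M}

theorem subset_bipolar {n : ℕ} (T : Set (Fin n → ℝ)) : T ⊆ bipolar T :=
  fun s hs _ _ h => h s hs

theorem abs_signSum_le_of_mem_bipolar {n : ℕ} {T : Set (Fin n → ℝ)} {s : Fin n → ℝ}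
    (hs : s ∈ bipolar T) (ξ : Fin n → ℤˣ) {M : ℝ} (h : ∀ t ∈ T, |signSum ξ t| ≤ M) :
    |signSum ξ s| ≤ M :=
  hs (fun i => ((ξ i : ℤ) : ℝ)) M h

theorem abs_apply_le_of_mem_bipolar {n : ℕ} {T : Set (Fin n → ℝ)} {s : Fin n → ℝ}
    (hs : s ∈ bipolar T) (i : Fin n) {M : ℝ} (h : ∀ t ∈ T, |t i| ≤ M) : |s i| ≤ M := by
  have := hs (fun j => if j = i then 1 else 0) M
  simpa using this (by simpa using h)

theorem abs_pairing_sum_le {n p : ℕ} {T : Set (Fin n → ℝ)} (hT : T.Nonempty) (a : Fin p → ℝ)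
    (t : Fin p → Fin n → ℝ) (ht : ∀ k, t k ∈ T) {C : ℝ} (hC : ∑ k, |a k| ≤ C)
    (c : Fin n → ℝ) {M : ℝ} (h : ∀ t ∈ T, |∑ i, c i * t i| ≤ M) :
    |∑ i, c i * ∑ k, a k * t k i| ≤ C * M := by
  have hM : 0 ≤ M := (abs_nonneg _).trans (h _ hT.some_mem)
  have hswap : ∑ i, c i * ∑ k, a k * t k i = ∑ k, a k * ∑ i, c i * t k i := by
    simp only [Finset.mul_sum]
    rw [Finset.sum_comm]
    exact Finset.sum_congr rfl fun k _ => Finset.sum_congr rfl fun i _ => by ring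
  rw [hswap]
  calc |∑ k, a k * ∑ i, c i * t k i| ≤ ∑ k, |a k * ∑ i, c i * t k i| :=
        Finset.abs_sum_le_sum_abs _ _
    _ ≤ ∑ k, |a k| * M := by
        refine Finset.sum_le_sum fun k _ => ?_
        rw [abs_mul]
        exact mul_le_mul_of_nonneg_left (h _ (ht k)) (abs_nonneg _)
    _ = (∑ k, |a k|) * M := by rw [Finset.sum_mul]
    _ ≤ C * M := mul_le_mul_of_nonneg_right hC hM

theorem exists_mem_bipolar_sum_eq {n p : ℕ} {T : Set (Fin n → ℝ)} (hT : T.Nonempty)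
    (a : Fin p → ℝ) (t : Fin p → Fin n → ℝ) (ht : ∀ k, t k ∈ T) {C : ℝ} (hC : ∑ k, |a k| ≤ C) :
    ∃ u ∈ bipolar T, ∀ i, ∑ k, a k * t k i = C * u i := by
  have hC0 : 0 ≤ C := (Finset.sum_nonneg fun k _ => abs_nonneg _).trans hC
  -- For `C = 0` all coefficients vanish and any point serves; otherwise divide by `C`.
  rcases hC0.eq_or_lt with h0 | hpos
  · refine ⟨hT.some, subset_bipolar T hT.some_mem, fun i => ?_⟩
    have hz : ∀ k, a k = 0 := fun k => abs_eq_zero.1 <| le_antisymm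
      ((Finset.single_le_sum (f := fun k => |a k|) (fun k _ => abs_nonneg _)
        (Finset.mem_univ k)).trans (hC.trans h0.ge)) (abs_nonneg _)
    simp [hz, ← h0]
  · refine ⟨fun i => C⁻¹ * ∑ k, a k * t k i, fun c M h => ?_, fun i => ?_⟩
    · have := abs_pairing_sum_le hT a t ht hC c h
      have heq : ∑ i, c i * (C⁻¹ * ∑ k, a k * t k i) = C⁻¹ * ∑ i, c i * ∑ k, a k * t k i := by
        rw [Finset.mul_sum]
        exact Finset.sum_congr rfl fun i _ => by ring
      rw [heq, abs_mul, abs_of_pos (inv_pos.2 hpos), inv_mul_le_iff₀ hpos]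
      exact this
    · rw [mul_inv_cancel_left₀ hpos.ne']

/-! ### Exponential moments, layer by layer -/

/-- The values of a neuron after `l` normalized hidden layers, from the values `T` of the
inputs. -/
def layerSet {n : ℕ} (T : Set (Fin n → ℝ)) : ℕ → Set (Fin n → ℝ)
  | 0 => T
  | l + 1 => (fun s i => relu (s i)) '' bipolar (layerSet T l)

theorem layerSet_nonempty {n : ℕ} {T : Set (Fin n → ℝ)} (hT : T.Nonempty) (l : ℕ) :
    (layerSet T l).Nonempty := by
  induction l with
  | zero => exact hT
  | succ l ih => exact (ih.mono (subset_bipolar _)).image _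

theorem layerSet_bounded {n : ℕ} {T : Set (Fin n → ℝ)} {C : ℝ} (h : ∀ t ∈ T, ∀ i, |t i| ≤ C)
    (l : ℕ) : ∀ t ∈ layerSet T l, ∀ i, |t i| ≤ C := by
  induction l with
  | zero => exact h
  | succ l ih =>
    rintro _ ⟨s, hs, rfl⟩ i
    exact (abs_relu_le _).trans (abs_apply_le_of_mem_bipolar hs i fun t ht => ih t ht i)

theorem sum_neg_signs {n : ℕ} (f : (Fin n → ℤˣ) → ℝ) : ∑ ξ, f (-ξ) = ∑ ξ, f ξ :=
  Equiv.sum_comp (Equiv.neg (Fin n → ℤˣ)) f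

theorem bddAbove_exp_of_bounded {n : ℕ} {T : Set (Fin n → ℝ)} {C : ℝ}
    (h : ∀ t ∈ T, ∀ i, |t i| ≤ C) (ξ : Fin n → ℤˣ) {l : ℝ} (hl : 0 ≤ l) :
    BddAbove (Set.range fun t : T => Real.exp (l * |signSum ξ t|)) := by
  refine ⟨Real.exp (l * (n * C)), ?_⟩
  rintro _ ⟨t, rfl⟩
  exact Real.exp_le_exp.2 (mul_le_mul_of_nonneg_left (abs_signSum_le ξ (h t t.2)) hl)

/-- The bipolar controls absolute linear functionals only, so the bound is moved through `log` and
back. -/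
theorem exp_le_iSup_of_mem_bipolar {n : ℕ} {T : Set (Fin n → ℝ)} (hT : T.Nonempty) {C : ℝ}
    (h : ∀ t ∈ T, ∀ i, |t i| ≤ C) (ξ : Fin n → ℤˣ) {l : ℝ} (hl : 0 < l) {s : Fin n → ℝ}
    (hs : s ∈ bipolar T) :
    Real.exp (l * |signSum ξ s|) ≤ ⨆ t : T, Real.exp (l * |signSum ξ t|) := by
  have hb := bddAbove_exp_of_bounded h ξ hl.le
  set R := ⨆ t : T, Real.exp (l * |signSum ξ t|) with hR
  have hRpos : 0 < R := (Real.exp_pos _).trans_le (le_ciSup hb ⟨_, hT.some_mem⟩)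
  rw [← Real.le_log_iff_exp_le hRpos, mul_comm, ← le_div_iff₀ hl]
  refine abs_signSum_le_of_mem_bipolar hs ξ fun t ht => ?_
  rw [le_div_iff₀ hl, mul_comm, Real.le_log_iff_exp_le hRpos]
  exact le_ciSup hb ⟨t, ht⟩

/-- Contraction needs a pairing without absolute value: `exp (l|z|) ≤ exp (lz) + exp (-lz)`, and the
symmetry `ξ ↦ -ξ` makes both terms equal on average. This is the factor 2. -/
theorem sum_iSup_exp_relu_bipolar_le {n : ℕ} {T : Set (Fin n → ℝ)} (hT : T.Nonempty) {C : ℝ}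
    (h : ∀ t ∈ T, ∀ i, |t i| ≤ C) {l : ℝ} (hl : 0 < l) :
    ∑ ξ : Fin n → ℤˣ, ⨆ t : ((fun s i => relu (s i)) '' bipolar T : Set (Fin n → ℝ)),
        Real.exp (l * |signSum ξ t|)
      ≤ 2 * ∑ ξ : Fin n → ℤˣ, ⨆ t : T, Real.exp (l * |signSum ξ t|) := by
  have hne : Nonempty (bipolar T) := (hT.mono (subset_bipolar T)).to_subtype
  have hne' : Nonempty ((fun s i => relu (s i)) '' bipolar T : Set (Fin n → ℝ)) :=
    ((hT.mono (subset_bipolar T)).image _).to_subtype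
  have hbd : ∀ s ∈ bipolar T, ∀ i, |s i| ≤ C :=
    fun s hs i => abs_apply_le_of_mem_bipolar hs i fun t ht => h t ht i
  let Z : (Fin n → ℤˣ) → ℝ := fun ξ =>
    ⨆ s : bipolar T, Real.exp (l * signSum ξ fun i => relu ((s : Fin n → ℝ) i))
  have hZb : ∀ ξ : Fin n → ℤˣ, BddAbove (Set.range fun s : bipolar T =>
      Real.exp (l * signSum ξ fun i => relu ((s : Fin n → ℝ) i))) := by
    intro ξ
    refine ⟨Real.exp (l * (n * C)), ?_⟩
    rintro _ ⟨s, rfl⟩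
    exact Real.exp_le_exp.2 (mul_le_mul_of_nonneg_left ((le_abs_self _).trans
      (abs_signSum_le ξ fun i => (abs_relu_le _).trans (hbd s s.2 i))) hl.le)
  have h1 : ∀ ξ : Fin n → ℤˣ,
      (⨆ t : ((fun s i => relu (s i)) '' bipolar T : Set (Fin n → ℝ)),
        Real.exp (l * |signSum ξ t|)) ≤ Z ξ + Z (-ξ) := by
    intro ξ
    refine ciSup_le ?_
    rintro ⟨_, s, hs, rfl⟩
    have e1 := le_ciSup (hZb ξ) ⟨s, hs⟩
    have e2 := le_ciSup (hZb (-ξ)) ⟨s, hs⟩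
    simp only [signSum_neg_left] at e2
    have p1 := Real.exp_pos (l * signSum ξ fun i => relu (s i))
    have p2 := Real.exp_pos (l * -signSum ξ fun i => relu (s i))
    simp only [Z, signSum_neg_left]
    rcases abs_choice (signSum ξ fun i => relu (s i)) with hc | hc <;> rw [hc] <;> linarith
  have h2 : ∑ ξ, Z ξ ≤ ∑ ξ : Fin n → ℤˣ, ⨆ t : T, Real.exp (l * |signSum ξ t|) := by
    have h3 := sum_iSup_exp_relu_le (fun _ : bipolar T => (0 : ℝ))
      (fun s i => l * (s : Fin n → ℝ) i) (A := 0) (C := l * C) (fun _ => le_rfl) (fun s i => by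
        rw [abs_mul, abs_of_pos hl]
        exact mul_le_mul_of_nonneg_left (hbd s s.2 i) hl.le)
    simp only [zero_add, relu_mul hl.le, signSum_smul] at h3
    refine h3.trans (Finset.sum_le_sum fun ξ _ => ciSup_le fun s => ?_)
    exact (Real.exp_le_exp.2 (mul_le_mul_of_nonneg_left (le_abs_self _) hl.le)).trans
      (exp_le_iSup_of_mem_bipolar hT h ξ hl s.2)
  calc _ ≤ ∑ ξ, (Z ξ + Z (-ξ)) := Finset.sum_le_sum fun ξ _ => h1 ξ
    _ = 2 * ∑ ξ, Z ξ := by rw [Finset.sum_add_distrib, sum_neg_signs, two_mul]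
    _ ≤ _ := mul_le_mul_of_nonneg_left h2 two_pos.le

theorem sum_iSup_exp_layerSet_le {n : ℕ} {T : Set (Fin n → ℝ)} (hT : T.Nonempty) {C : ℝ}
    (h : ∀ t ∈ T, ∀ i, |t i| ≤ C) {l : ℝ} (hl : 0 < l) (m : ℕ) :
    ∑ ξ : Fin n → ℤˣ, ⨆ t : layerSet T m, Real.exp (l * |signSum ξ t|)
      ≤ 2 ^ m * ∑ ξ : Fin n → ℤˣ, ⨆ t : T, Real.exp (l * |signSum ξ t|) := by
  induction m with
  | zero => simp [layerSet]
  | succ m ih =>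
    refine (sum_iSup_exp_relu_bipolar_le (layerSet_nonempty hT m) (layerSet_bounded h m) hl).trans ?_
    rw [pow_succ']
    linarith

/-- Union bound: the supremum is at most the sum over the `2m` signed vectors, each sub-Gaussian. -/
theorem sum_iSup_exp_range_le {n m : ℕ} [NeZero m] (y : Fin m → Fin n → ℝ) {D l : ℝ}
    (hD : ∀ j, ∑ i, y j i ^ 2 ≤ D ^ 2) :
    ∑ ξ : Fin n → ℤˣ, ⨆ t : Set.range y, Real.exp (l * |signSum ξ t|)
      ≤ 2 ^ n * (2 * m * Real.exp (l ^ 2 * D ^ 2 / 2)) := by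
  have hne : Nonempty (Set.range y) := (Set.range_nonempty y).to_subtype
  have h1 : ∀ ξ : Fin n → ℤˣ, (⨆ t : Set.range y, Real.exp (l * |signSum ξ t|))
      ≤ ∑ j, (Real.exp (signSum ξ fun i => l * y j i)
        + Real.exp (signSum (-ξ) fun i => l * y j i)) := by
    intro ξ
    refine ciSup_le ?_
    rintro ⟨_, j, rfl⟩
    refine le_trans ?_ (Finset.single_le_sum (f := fun j =>
      Real.exp (signSum ξ fun i => l * y j i) + Real.exp (signSum (-ξ) fun i => l * y j i))
      (fun j _ => by positivity) (Finset.mem_univ j))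
    simp only [signSum_neg_left, signSum_smul]
    have p1 := Real.exp_pos (l * signSum ξ (y j))
    have p2 := Real.exp_pos (-(l * signSum ξ (y j)))
    rw [mul_neg]
    rcases abs_choice (signSum ξ (y j)) with hc | hc <;> rw [hc]
    · linarith
    · rw [mul_neg]; linarith
  refine (Finset.sum_le_sum fun ξ _ => h1 ξ).trans ?_
  rw [Finset.sum_comm]
  have h2 : ∀ j, ∑ ξ : Fin n → ℤˣ, (Real.exp (signSum ξ fun i => l * y j i)
        + Real.exp (signSum (-ξ) fun i => l * y j i))
      ≤ 2 * (2 ^ n * Real.exp (l ^ 2 * D ^ 2 / 2)) := by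
    intro j
    rw [Finset.sum_add_distrib, sum_neg_signs fun ξ => Real.exp (signSum ξ fun i => l * y j i),
      ← two_mul]
    refine mul_le_mul_of_nonneg_left ((sum_exp_signSum_le _).trans ?_) two_pos.le
    refine mul_le_mul_of_nonneg_left (Real.exp_le_exp.2 ?_) (by positivity)
    simp only [mul_pow, ← Finset.mul_sum]
    have := mul_le_mul_of_nonneg_left (hD j) (sq_nonneg l)
    linarith
  refine (Finset.sum_le_sum fun j _ => h2 j).trans (le_of_eq ?_)
  simp
  ring

/-- The expected largest pairing of a sign vector with the neurons after `m` hidden layers. -/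
theorem sum_iSup_abs_signSum_layerSet_le {n m k : ℕ} [NeZero k] (y : Fin k → Fin n → ℝ) {D : ℝ}
    (hD0 : 0 < D) (hD : ∀ j, ∑ i, y j i ^ 2 ≤ D ^ 2) :
    ∑ ξ : Fin n → ℤˣ, (⨆ t : layerSet (Set.range y) m, |signSum ξ t|)
      ≤ 2 ^ n * (√(2 * (m + 2 + Real.log k)) * D) := by
  have hk : (1 : ℝ) ≤ k := by exact_mod_cast NeZero.one_le
  have hlog : 0 ≤ Real.log k := Real.log_nonneg hk
  -- An upper bound for the logarithm of the prefactor `2 ^ m * 2 * k`.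
  set G : ℝ := m + 2 + Real.log k with hG
  have hGpos : 0 < G := by positivity
  set r := √(2 * G) with hr
  have hrpos : 0 < r := Real.sqrt_pos.2 (by positivity)
  have hr2 : r ^ 2 = 2 * G := Real.sq_sqrt (by positivity)
  -- The minimizer of `(G + l² D² / 2) / l`, with minimum `√(2G) * D`.
  set l := r / D with hl'
  have hl : 0 < l := by positivity
  have hT : (Set.range y).Nonempty := Set.range_nonempty y
  have hbd : ∀ t ∈ Set.range y, ∀ i, |t i| ≤ D := by
    rintro _ ⟨j, rfl⟩ i
    refine abs_le_of_sq_le_sq ?_ hD0.le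
    exact (Finset.single_le_sum (f := fun i => y j i ^ 2) (fun i _ => sq_nonneg _)
      (Finset.mem_univ i)).trans (hD j)
  have hne : Nonempty (layerSet (Set.range y) m) := (layerSet_nonempty hT m).to_subtype
  let f : (Fin n → ℤˣ) → ℝ := fun ξ => ⨆ t : layerSet (Set.range y) m, |signSum ξ t|
  have hexp : ∑ ξ, Real.exp (l * f ξ) ≤ 2 ^ n * (2 ^ m * (2 * k * Real.exp (l ^ 2 * D ^ 2 / 2))) := by
    have h1 := sum_iSup_exp_layerSet_le hT hbd hl m
    have h2 := sum_iSup_exp_range_le (l := l) y hD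
    refine le_trans (Finset.sum_le_sum fun ξ _ => ?_)
      (h1.trans ((mul_le_mul_of_nonneg_left h2 (by positivity)).trans (le_of_eq (by ring))))
    have hb := bddAbove_exp_of_bounded (layerSet_bounded hbd m) ξ hl.le
    set R := ⨆ t : layerSet (Set.range y) m, Real.exp (l * |signSum ξ t|) with hR
    have hRpos : 0 < R := (Real.exp_pos _).trans_le (le_ciSup hb hne.some)
    rw [← Real.le_log_iff_exp_le hRpos, mul_comm, ← le_div_iff₀ hl]
    refine ciSup_le fun t => ?_
    rw [le_div_iff₀ hl, mul_comm, Real.le_log_iff_exp_le hRpos]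
    exact le_ciSup hb t
  have hjensen : Real.exp (∑ ξ, (1 / 2 ^ n : ℝ) • (l * f ξ))
      ≤ ∑ ξ, (1 / 2 ^ n : ℝ) • Real.exp (l * f ξ) :=
    convexOn_exp.map_sum_le (fun _ _ => by positivity)
      (by rw [Finset.sum_const, Finset.card_univ, nsmul_eq_mul, card_signs]; field_simp)
      (fun _ _ => Set.mem_univ _)
  simp only [smul_eq_mul, ← Finset.mul_sum] at hjensen
  have hfin : Real.exp (1 / 2 ^ n * (l * ∑ ξ, f ξ)) ≤ Real.exp (G + l ^ 2 * D ^ 2 / 2) := by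
    refine hjensen.trans ((mul_le_mul_of_nonneg_left hexp (by positivity)).trans ?_)
    rw [Real.exp_add, hG, Real.exp_add, Real.exp_log (by positivity)]
    have h2e : (2 : ℝ) ≤ Real.exp 1 := by linarith [Real.add_one_le_exp (1 : ℝ)]
    have h3 : (2 : ℝ) ^ (m + 2) ≤ Real.exp (m + 2) := by
      rw [show ((m : ℝ) + 2) = ((m + 2 : ℕ) : ℝ) * 1 by push_cast; ring, Real.exp_nat_mul]
      exact pow_le_pow_left₀ two_pos.le h2e _
    have h4 : (2 : ℝ) ^ m * 2 ≤ Real.exp (m + 2) := by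
      refine le_trans ?_ h3
      rw [pow_add]
      nlinarith [pow_pos (two_pos : (0 : ℝ) < 2) m]
    have h5 := mul_le_mul_of_nonneg_right h4
      (by positivity : (0 : ℝ) ≤ k * Real.exp (l ^ 2 * D ^ 2 / 2))
    refine le_trans (le_of_eq ?_) (h5.trans (le_of_eq ?_))
    · field_simp
    · ring
  have hlin := Real.exp_le_exp.1 hfin
  have hlD : l * D = r := div_mul_cancel₀ r hD0.ne'
  have h6 : l ^ 2 * D ^ 2 / 2 = G := by rw [← mul_pow, hlD, hr2]; ring
  rw [h6, div_mul_eq_mul_div, one_mul, div_le_iff₀ (by positivity)] at hlin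
  refine le_of_mul_le_mul_left (a := l) (hlin.trans (le_of_eq ?_)) hl
  calc (G + G) * 2 ^ n = 2 ^ n * r ^ 2 := by rw [hr2]; ring
    _ = l * (2 ^ n * (r * D)) := by rw [← hlD]; ring

/-! ### Matrix norms and networks -/

/-- Test the operator norm on the sign vector of the row. -/
theorem sum_abs_row_le_matNorm {m n : ℕ} (A : Matrix (Fin m) (Fin n) ℝ) (j : Fin m) :
    ∑ k, |A j k| ≤ matNorm A := by
  let y : Fin n → ℝ := fun k => SignType.sign (A j k)
  have hy : ‖y‖ ≤ 1 := by
    refine (pi_norm_le_iff_of_nonneg zero_le_one).2 fun k => ?_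
    rcases lt_trichotomy (A j k) 0 with h | h | h <;> simp [y, h]
  have h1 := (LinearMap.toContinuousLinearMap (Matrix.mulVecLin A)).le_opNorm y
  have h2 : ∑ k, |A j k| = A.mulVec y j := by
    simp only [Matrix.mulVec, dotProduct, y]
    exact Finset.sum_congr rfl fun k _ => by rw [mul_comm, sign_mul_self]
  calc ∑ k, |A j k| ≤ ‖A.mulVec y j‖ := by rw [h2]; exact le_abs_self _
    _ ≤ ‖A.mulVec y‖ := norm_le_pi_norm _ j
    _ ≤ matNorm A * ‖y‖ := h1
    _ ≤ matNorm A := mul_le_of_le_one_right (norm_nonneg _) hy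

theorem matNorm_le_of_sum_abs_row_le {m n : ℕ} (A : Matrix (Fin m) (Fin n) ℝ) {C : ℝ}
    (hC : 0 ≤ C) (h : ∀ j, ∑ k, |A j k| ≤ C) : matNorm A ≤ C := by
  refine ContinuousLinearMap.opNorm_le_bound _ hC fun y => ?_
  refine (pi_norm_le_iff_of_nonneg (by positivity)).2 fun j => ?_
  change |∑ k, A j k * y k| ≤ C * ‖y‖
  calc |∑ k, A j k * y k| ≤ ∑ k, |A j k * y k| := Finset.abs_sum_le_sum_abs _ _
    _ ≤ ∑ k, |A j k| * ‖y‖ := by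
        refine Finset.sum_le_sum fun k _ => ?_
        rw [abs_mul]
        exact mul_le_mul_of_nonneg_left (norm_le_pi_norm y k) (abs_nonneg _)
    _ = (∑ k, |A j k|) * ‖y‖ := by rw [Finset.sum_mul]
    _ ≤ C * ‖y‖ := mul_le_mul_of_nonneg_right (h j) (norm_nonneg _)

theorem matNorm_nonneg {m n : ℕ} (A : Matrix (Fin m) (Fin n) ℝ) : 0 ≤ matNorm A :=
  norm_nonneg _

namespace HiddenLayers

theorem normProd_nonneg {m L p : ℕ} (H : HiddenLayers m L p) : 0 ≤ H.normProd := by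
  induction H with
  | nil => exact zero_le_one
  | snoc H A ih => exact mul_nonneg ih (matNorm_nonneg A)

theorem exists_mem_layerSet {m n L p : ℕ} [NeZero m] (H : HiddenLayers m L p)
    (y : Fin n → Fin m → ℝ) (j : Fin p) :
    ∃ t ∈ layerSet (Set.range fun j i => y i j) L, ∀ i, H.eval (y i) j = H.normProd * t i := by
  induction H with
  | nil => exact ⟨fun i => y i j, ⟨j, rfl⟩, fun i => by simp [eval, normProd]⟩
  | snoc H A ih =>
    choose t ht hti using ih
    obtain ⟨u, hu, hui⟩ := exists_mem_bipolar_sum_eq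
      (layerSet_nonempty (Set.range_nonempty fun j i => y i j) _) (A j) t ht
      (sum_abs_row_le_matNorm A j)
    refine ⟨fun i => relu (u i), ⟨u, hu, rfl⟩, fun i => ?_⟩
    have h0 : 0 ≤ H.normProd * matNorm A := mul_nonneg H.normProd_nonneg (matNorm_nonneg A)
    simp only [eval, normProd]
    rw [← relu_mul h0]
    congr 1
    simp only [Matrix.mulVec, dotProduct, hti]
    rw [mul_assoc, ← hui, Finset.mul_sum]
    exact Finset.sum_congr rfl fun k _ => by ring

/-- The network of constant width `w` whose `l + 1` hidden layers all have equal neurons, with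
value `relu (a ⬝ᵥ y)`. -/
noncomputable def ridge {m : ℕ} (w : ℕ) (a : Fin m → ℝ) : (l : ℕ) → HiddenLayers m (l + 1) w
  | 0 => snoc nil (Matrix.of fun _ k => a k)
  -- Identity layers pad the depth for free: their norm is at most 1 and `relu` fixes nonnegative
  -- values.
  | l + 1 => snoc (ridge w a l) 1

theorem ridge_eval {m : ℕ} (w : ℕ) (a : Fin m → ℝ) (l : ℕ) (y : Fin m → ℝ) (j : Fin w) :
    (ridge w a l).eval y j = relu (∑ k, a k * y k) := by
  induction l with
  | zero => rfl
  | succ l ih => simp only [ridge, eval, Matrix.one_mulVec, ih, relu_of_nonneg (relu_nonneg _)]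

theorem ridge_posWidths {m w : ℕ} (hw : 1 ≤ w) (a : Fin m → ℝ) (l : ℕ) :
    (ridge w a l).PosWidths := by
  induction l with
  | zero => exact ⟨trivial, hw⟩
  | succ l ih => exact ⟨ih, hw⟩

theorem ridge_width {m : ℕ} (w : ℕ) (a : Fin m → ℝ) (l : ℕ) : (ridge w a l).width = w := by
  induction l with
  | zero => simp [ridge, width]
  | succ l ih => simp [ridge, width, ih]

theorem ridge_normProd_le {m : ℕ} (w : ℕ) (a : Fin m → ℝ) (ha : ∑ k, |a k| ≤ 1) (l : ℕ) :
    (ridge w a l).normProd ≤ 1 := by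
  induction l with
  | zero =>
    simp only [ridge, normProd, one_mul]
    exact matNorm_le_of_sum_abs_row_le _ zero_le_one fun j => ha
  | succ l ih =>
    refine mul_le_one₀ ih (matNorm_nonneg _) ?_
    refine matNorm_le_of_sum_abs_row_le _ zero_le_one fun j => ?_
    simp [Matrix.one_apply, apply_ite abs]

end HiddenLayers

/-! ### The sample set -/

theorem smul_relu_mem_sampleSet {d n W L : ℕ} (hW : 1 ≤ W) (hL : 1 ≤ L) {K : ℝ}
    (x : Fin n → Fin d → ℝ) {c e : ℝ} (hc : |c| ≤ K) (he : |e| ≤ 1) (j : Fin (d + 1)) :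
    (fun i => c * relu (e * augment (x i) j)) ∈ sampleSet W L K x := by
  obtain ⟨l, rfl⟩ : ∃ l, L = l + 1 := ⟨L - 1, by omega⟩
  let a : Fin (d + 1) → ℝ := Pi.single j e
  -- All neurons of the last layer agree; reading only one keeps the output norm at most `K` at any
  -- width.
  let A : Matrix (Fin 1) (Fin W) ℝ := Matrix.of fun _ k => if k = ⟨0, hW⟩ then c else 0
  have ha : ∑ k, |a k| ≤ 1 := by
    simpa [a, Pi.single_apply, apply_ite abs] using he
  have hA : matNorm A ≤ K := by
    refine matNorm_le_of_sum_abs_row_le _ ((abs_nonneg c).trans hc) fun _ => ?_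
    simpa [A, apply_ite abs] using hc
  refine ⟨_, ⟨W, HiddenLayers.ridge W a l, A, HiddenLayers.ridge_posWidths hW a l,
    HiddenLayers.ridge_width W a l, ?_, fun x => rfl⟩, fun i => ?_⟩
  · exact (mul_le_of_le_one_left (matNorm_nonneg A) (HiddenLayers.ridge_normProd_le W a ha l)).trans
      hA
  · simp [Matrix.mulVec, dotProduct, HiddenLayers.ridge_eval, A, a, Pi.single_apply]

/-- Coordinate functionals `c` will give boundedness, sign vectors the complexity bound. -/
theorem abs_pairing_le_of_mem_sampleSet {d n W L : ℕ} {K : ℝ} {x : Fin n → Fin d → ℝ}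
    {s : Fin n → ℝ} (hs : s ∈ sampleSet W L K x) (c : Fin n → ℝ) {M : ℝ}
    (h : ∀ t ∈ layerSet (Set.range fun j i => augment (x i) j) L, |∑ i, c i * t i| ≤ M) :
    |∑ i, c i * s i| ≤ K * M := by
  obtain ⟨φ, ⟨p, H, A, -, -, hK, hφ⟩, hs⟩ := hs
  choose t ht hti using fun j => H.exists_mem_layerSet (fun i => augment (x i)) j
  have hT := layerSet_nonempty (Set.range_nonempty fun j i => augment (x i) j) L
  have h1 := abs_pairing_sum_le hT (A 0) t ht (sum_abs_row_le_matNorm A 0) c h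
  have heq : ∑ i, c i * s i = H.normProd * ∑ i, c i * ∑ k, A 0 k * t k i := by
    rw [Finset.mul_sum]
    refine Finset.sum_congr rfl fun i _ => ?_
    rw [hs, hφ]
    simp only [Matrix.mulVec, dotProduct, hti]
    simp only [Finset.mul_sum]
    exact Finset.sum_congr rfl fun k _ => by ring
  rw [heq, abs_mul, abs_of_nonneg H.normProd_nonneg]
  refine (mul_le_mul_of_nonneg_left h1 H.normProd_nonneg).trans ?_
  rw [← mul_assoc]
  exact mul_le_mul_of_nonneg_right hK ((abs_nonneg _).trans (h _ hT.some_mem))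

theorem augment_last {d : ℕ} (x : Fin d → ℝ) : augment x (Fin.last d) = 1 := by
  simp [augment]

theorem abs_augment_le {d : ℕ} {x : Fin d → ℝ} {B : ℝ} (hB : 1 ≤ B)
    (hx : ∀ j, x j ∈ Set.Icc (-B) B) (j : Fin (d + 1)) : |augment x j| ≤ B := by
  induction j using Fin.lastCases with
  | last => simpa [augment_last] using hB
  | cast j => simpa [augment] using abs_le.2 (hx j)

theorem sqrt_le_maxColNorm {d n : ℕ} (x : Fin n → Fin d → ℝ) (j : Fin (d + 1)) :
    √(∑ i, augment (x i) j ^ 2) ≤ maxColNorm x :=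
  Finset.le_sup' (fun j => √(∑ i, augment (x i) j ^ 2)) (Finset.mem_univ j)

theorem sqrt_card_le_maxColNorm {d n : ℕ} (x : Fin n → Fin d → ℝ) : √n ≤ maxColNorm x := by
  simpa [augment_last] using sqrt_le_maxColNorm x (Fin.last d)

theorem maxColNorm_le {d n : ℕ} {x : Fin n → Fin d → ℝ} {B : ℝ} (hB : 1 ≤ B)
    (hx : ∀ i j, x i j ∈ Set.Icc (-B) B) : maxColNorm x ≤ B * √n := by
  have hB0 : 0 ≤ B := zero_le_one.trans hB
  refine Finset.sup'_le _ _ fun j _ => ?_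
  rw [Real.sqrt_le_left (by positivity), mul_pow, Real.sq_sqrt (Nat.cast_nonneg n)]
  refine (Finset.sum_le_sum fun i _ => sq_le_sq' (neg_le_of_abs_le (abs_augment_le hB (hx i) j))
    (le_of_abs_le (abs_augment_le hB (hx i) j))).trans (le_of_eq ?_)
  simp [mul_comm]

theorem abs_apply_le_of_mem_layerSet {d n L : ℕ} {x : Fin n → Fin d → ℝ} {B : ℝ} (hB : 1 ≤ B)
    (hx : ∀ i j, x i j ∈ Set.Icc (-B) B) :
    ∀ t ∈ layerSet (Set.range fun j i => augment (x i) j) L, ∀ i, |t i| ≤ B := by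
  refine layerSet_bounded ?_ L
  rintro _ ⟨j, rfl⟩ i
  exact abs_augment_le hB (hx i) j

theorem abs_apply_le_of_mem_sampleSet {d n W L : ℕ} {B K : ℝ} {x : Fin n → Fin d → ℝ}
    (hB : 1 ≤ B) (hx : ∀ i j, x i j ∈ Set.Icc (-B) B) {s : Fin n → ℝ}
    (hs : s ∈ sampleSet W L K x) (i : Fin n) : |s i| ≤ K * B := by
  have := abs_pairing_le_of_mem_sampleSet hs (fun k => if k = i then 1 else 0) (M := B)
    (by simpa using fun t ht => abs_apply_le_of_mem_layerSet hB hx t ht i)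
  simpa using this

/-! ### The two bounds -/

theorem rademacherComplexity_sampleSet_le {d n W L : ℕ} {B K : ℝ} (hn : 1 ≤ n) (hB : 1 ≤ B)
    (hK : 0 ≤ K) {x : Fin n → Fin d → ℝ} (hx : ∀ i j, x i j ∈ Set.Icc (-B) B)
    (hne : (sampleSet W L K x).Nonempty) :
    rademacherComplexity (sampleSet W L K x)
      ≤ 1 / (n : ℝ) * K * √(2 * ((L : ℝ) + 2 + Real.log ((d : ℝ) + 1))) * maxColNorm x := by
  have hn0 : (0 : ℝ) < n := by exact_mod_cast hn
  have hD0 : 0 < maxColNorm x := (Real.sqrt_pos.2 hn0).trans_le (sqrt_card_le_maxColNorm x)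
  set T := Set.range fun (j : Fin (d + 1)) i => augment (x i) j with hT
  have hmain := sum_iSup_abs_signSum_layerSet_le (m := L)
    (fun (j : Fin (d + 1)) i => augment (x i) j) hD0 fun j =>
      (Real.sqrt_le_left hD0.le).1 (sqrt_le_maxColNorm x j)
  rw [← hT] at hmain
  have hsup : ∀ ξ : Fin n → ℤˣ,
      sSup ((fun s : Fin n → ℝ => (1 / n : ℝ) * ∑ i, ((ξ i : ℤ) : ℝ) * s i) '' sampleSet W L K x)
        ≤ 1 / n * (K * ⨆ t : layerSet T L, |signSum ξ t|) := by
    intro ξ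
    refine csSup_le (hne.image _) ?_
    rintro _ ⟨s, hs, rfl⟩
    refine mul_le_mul_of_nonneg_left ((le_abs_self _).trans ?_) (by positivity)
    refine abs_pairing_le_of_mem_sampleSet hs _ fun t ht => ?_
    refine le_ciSup (f := fun t : layerSet T L => |signSum ξ t|) ⟨n * B, ?_⟩ ⟨t, ht⟩
    rintro _ ⟨t, rfl⟩
    exact abs_signSum_le ξ fun i => abs_apply_le_of_mem_layerSet hB hx t t.2 i
  calc rademacherComplexity (sampleSet W L K x)
      ≤ 1 / 2 ^ n * ∑ ξ : Fin n → ℤˣ, 1 / n * (K * ⨆ t : layerSet T L, |signSum ξ t|) :=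
        mul_le_mul_of_nonneg_left (Finset.sum_le_sum fun ξ _ => hsup ξ) (by positivity)
    _ = 1 / 2 ^ n * (1 / n * (K * ∑ ξ : Fin n → ℤˣ, ⨆ t : layerSet T L, |signSum ξ t|)) := by
        simp only [Finset.mul_sum]
    _ ≤ 1 / 2 ^ n * (1 / n * (K *
          (2 ^ n * (√(2 * (L + 2 + Real.log ((d + 1 : ℕ) : ℝ))) * maxColNorm x)))) := by
        gcongr
    _ = _ := by
        push_cast
        field_simp

theorem le_rademacherComplexity_sampleSet {d n W L : ℕ} {B K : ℝ} (hW : 1 ≤ W)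
    (hL : 1 ≤ L) (hB : 1 ≤ B) (hK : 0 ≤ K) {x : Fin n → Fin d → ℝ}
    (hx : ∀ i j, x i j ∈ Set.Icc (-B) B) :
    K / (2 * √2 * (n : ℝ)) * maxColNorm x ≤ rademacherComplexity (sampleSet W L K x) := by
  obtain ⟨j, -, hj⟩ := Finset.exists_mem_eq_sup' Finset.univ_nonempty
    (fun j : Fin (d + 1) => √(∑ i, augment (x i) j ^ 2))
  have hj : maxColNorm x = √(∑ i, augment (x i) j ^ 2) := hj
  set D := maxColNorm x with hD
  have hD0 : 0 ≤ D := hj ▸ Real.sqrt_nonneg _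
  have hD2 : D ^ 2 = ∑ i, augment (x i) j ^ 2 := by
    rw [hj, Real.sq_sqrt (Finset.sum_nonneg fun i _ => sq_nonneg _)]
  -- The positive and negative parts of the column share `D ^ 2`, so one has at least half.
  obtain ⟨e, he, hv⟩ : ∃ e : ℝ, |e| ≤ 1 ∧
      D / √2 ≤ √(∑ i, relu (e * augment (x i) j) ^ 2) := by
    have hsplit : ∑ i, relu (1 * augment (x i) j) ^ 2 + ∑ i, relu (-1 * augment (x i) j) ^ 2
        = D ^ 2 := by
      rw [← Finset.sum_add_distrib, hD2]
      refine Finset.sum_congr rfl fun i _ => ?_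
      rw [one_mul, neg_one_mul, relu_sq_add_relu_neg_sq]
    have hsq : (D / √2) ^ 2 = D ^ 2 / 2 := by rw [div_pow, Real.sq_sqrt two_pos.le]
    by_cases hc : D ^ 2 / 2 ≤ ∑ i, relu (1 * augment (x i) j) ^ 2
    · exact ⟨1, by simp, Real.le_sqrt_of_sq_le (hsq ▸ hc)⟩
    · exact ⟨-1, by simp, Real.le_sqrt_of_sq_le (by rw [hsq]; linarith)⟩
  set v : Fin n → ℝ := fun i => relu (e * augment (x i) j) with hvdef
  have hsup : ∀ ξ : Fin n → ℤˣ, 1 / n * (K * |signSum ξ v|) ≤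
      sSup ((fun s : Fin n → ℝ => (1 / n : ℝ) * ∑ i, ((ξ i : ℤ) : ℝ) * s i) ''
        sampleSet W L K x) := by
    intro ξ
    have hbd : BddAbove ((fun s : Fin n → ℝ => (1 / n : ℝ) * ∑ i, ((ξ i : ℤ) : ℝ) * s i) ''
        sampleSet W L K x) := by
      refine ⟨1 / n * (n * (K * B)), ?_⟩
      rintro _ ⟨s, hs, rfl⟩
      exact mul_le_mul_of_nonneg_left ((le_abs_self _).trans
        (abs_signSum_le ξ fun i => abs_apply_le_of_mem_sampleSet hB hx hs i)) (by positivity)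
    have hmem : ∀ c : ℝ, |c| ≤ K → 1 / n * (c * signSum ξ v) ≤ _ := fun c hc =>
      le_csSup hbd ⟨_, smul_relu_mem_sampleSet hW hL x hc he j,
        congrArg (1 / (n : ℝ) * ·) (signSum_smul ξ c v)⟩
    -- Taking `c = K` or `c = -K` according to the sign of the pairing produces the absolute value.
    rcases abs_choice (signSum ξ v) with h | h <;> rw [h]
    · exact hmem K (abs_of_nonneg hK).le
    · have := hmem (-K) (by rw [abs_neg, abs_of_nonneg hK])
      rwa [neg_mul, ← mul_neg] at this
  have hkh : 2 ^ n * (1 / 2 * (D / √2)) ≤ ∑ ξ : Fin n → ℤˣ, |signSum ξ v| :=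
    le_trans (by gcongr) (half_sqrt_le_sum_abs_signSum v)
  calc K / (2 * √2 * (n : ℝ)) * D
      = 1 / 2 ^ n * (1 / n * (K * (2 ^ n * (1 / 2 * (D / √2))))) := by
        have h2n : (2 : ℝ) ^ n ≠ 0 := by positivity
        rw [show (1 / 2 ^ n * (1 / (n : ℝ) * (K * (2 ^ n * (1 / 2 * (D / √2)))))) =
          (2 ^ n / 2 ^ n) * (K * (1 / n) * (1 / 2) * (D / √2)) by ring, div_self h2n]
        simp only [div_eq_mul_inv, mul_inv]
        ring
    _ ≤ 1 / 2 ^ n * (1 / n * (K * ∑ ξ : Fin n → ℤˣ, |signSum ξ v|)) := by gcongr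
    _ = 1 / 2 ^ n * ∑ ξ : Fin n → ℤˣ, 1 / n * (K * |signSum ξ v|) := by
        simp only [Finset.mul_sum]
    _ ≤ rademacherComplexity (sampleSet W L K x) :=
        mul_le_mul_of_nonneg_left (Finset.sum_le_sum fun ξ _ => hsup ξ) (by positivity)

theorem lemma2p3 (d n W L : ℕ) (hn : 1 ≤ n) (hW : 1 ≤ W) (hL : 1 ≤ L)
    (B K : ℝ) (hB : 1 ≤ B) (hK : 0 ≤ K)
    (x : Fin n → Fin d → ℝ) (hx : ∀ i j, x i j ∈ Set.Icc (-B) B) :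
    (sampleSet W L K x).Nonempty ∧ Bornology.IsBounded (sampleSet W L K x) ∧
    rademacherComplexity (sampleSet W L K x)
      ≤ 1 / (n : ℝ) * K * Real.sqrt (2 * ((L : ℝ) + 2 + Real.log ((d : ℝ) + 1))) * maxColNorm x ∧
    1 / (n : ℝ) * K * Real.sqrt (2 * ((L : ℝ) + 2 + Real.log ((d : ℝ) + 1))) * maxColNorm x
      ≤ B * K * Real.sqrt (2 * ((L : ℝ) + 2 + Real.log ((d : ℝ) + 1))) / Real.sqrt (n : ℝ) ∧
    (2 ≤ W →
      K / (2 * Real.sqrt 2 * (n : ℝ)) * maxColNorm x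
        ≤ rademacherComplexity (sampleSet W L K x) ∧
      K / (2 * Real.sqrt (2 * (n : ℝ))) ≤ K / (2 * Real.sqrt 2 * (n : ℝ)) * maxColNorm x) := by
  have hn0 : (0 : ℝ) < n := by exact_mod_cast hn
  have hne : (sampleSet W L K x).Nonempty :=
    ⟨_, smul_relu_mem_sampleSet hW hL x (abs_of_nonneg hK).le (by simp : |(1 : ℝ)| ≤ 1) 0⟩
  have hrn : 0 < √(n : ℝ) := Real.sqrt_pos.2 hn0
  have hrn2 : √(n : ℝ) * √(n : ℝ) = n := Real.mul_self_sqrt hn0.le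
  refine ⟨hne, ?_, rademacherComplexity_sampleSet_le hn hB hK hx hne, ?_, fun _ =>
    ⟨le_rademacherComplexity_sampleSet hW hL hB hK hx, ?_⟩⟩
  · refine isBounded_iff_forall_norm_le.2 ⟨K * B, fun s hs => ?_⟩
    exact (pi_norm_le_iff_of_nonneg (by positivity)).2
      fun i => abs_apply_le_of_mem_sampleSet hB hx hs i
  · refine (mul_le_mul_of_nonneg_left (maxColNorm_le hB hx) (by positivity)).trans (le_of_eq ?_)
    nth_rewrite 1 [← hrn2]
    field_simp
  -- The constant column of ones already has norm `√n`.
  · refine le_trans (le_of_eq ?_) (mul_le_mul_of_nonneg_left (sqrt_card_le_maxColNorm x)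
      (by positivity))
    rw [Real.sqrt_mul two_pos.le]
    nth_rewrite 2 [← hrn2]
    field_simp
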